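/- Regard $\mathbb{R}^2$ as a subset of the real projective plane $\mathbb{RP}^2$ via $(x,y)\mapsto[x:y:1]$. Two distinct points $p,q$ of $\mathbb{RP}^2$ divide the projective line through them into two (closed) projective line segments joining $p$ and $q$ (if $p=q$, the only segment is $\{p\}$). A set $X\subseteq\mathbb{RP}^2$ is \emph{convex} if any two of its points can be joined by a projective line segment contained in $X$ and $X$ is disjoint from some projective line. A \emph{projective convex hull} of $Y\subseteq\mathbb{RP}^2$ is an inclusion-wise minimal convex set containing $Y$ (it need not be unique). For $k\ge 3$ and a finite set $P\subset\mathbb{RP}^2$ with no three points on a projective line, a \emph{projective $k$-hole} in $P$ is a projective convex hull of some $k$-point set $I\subseteq P$ that has all points of $I$ on its boundary and has no point of $P$ in its interior. For a finite set $P\subset\mathbb{R}^2$, an \emph{affine $k$-hole} in $P$ is a convex polygon whose vertex set is a $k$-point subset of $P$ and whose interior contains no point of $P$. Let $P$ be a set of $n$ points in $\mathbb{R}^2\subset\mathbb{RP}^2$ in general position, that is, with no three points on a common line. Let $h_k(P)$ be the number of affine $k$-holes in $P$ and let $h_k^p(P)$ be the number of projective $k$-holes in $P$. Then \[ h_3^p(P)\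 \ge\ h_3(P)+\frac13\binom n2\quad\text{if } n\ne 2, \qquad\text{and}\qquad h_4^p(P)\ \ge\ h_4(P)+\frac12\left(\binom n2-3n+3\right)\quad\text{if } n\ge 1 . \] -/

import Mathlib

open scoped LinearAlgebra.Projectivization

noncomputable section

/-- The Euclidean plane. -/
abbrev Plane : Type := EuclideanSpace ℝ (Fin 2)

/-- A set in the plane is in general position if no three of its points lie on a common line. -/
def InGeneralPosition (S : Set Plane) : Prop :=
  ∀ a ∈ S, ∀ b ∈ S, ∀ c ∈ S, a ≠ b → a ≠ c → b ≠ c → ¬ Collinear ℝ {a, b, c}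

/-- `Q` is an (affine) `k`-gon determined by `S`: the convex polygon whose vertex set is a
`k`-element subset `I` of `S` in convex position. -/
def IsAffineGon (k : ℕ) (S : Set Plane) (Q : Set Plane) : Prop :=
  ∃ I : Finset Plane, (I : Set Plane) ⊆ S ∧ I.card = k ∧
    ConvexIndependent ℝ (fun x : I => (x : Plane)) ∧ Q = convexHull ℝ (I : Set Plane)

/-- An (affine) `k`-hole in `S`: a `k`-gon determined by `S` with no point of `S` in its
interior. -/
def IsAffineHole (k : ℕ) (S : Set Plane) (Q : Set Plane) : Prop :=
  IsAffineGon k S Q ∧ ∀ p ∈ S, p ∉ interior Q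

/-- The number of affine `k`-holes in `S`. -/
def numAffineHoles (k : ℕ) (S : Set Plane) : ℕ :=
  {Q : Set Plane | IsAffineHole k S Q}.ncard

/-- The real projective plane. -/
abbrev RP2 : Type := ℙ ℝ (Fin 3 → ℝ)

/-- The usual topology of the real projective plane: the quotient topology from the nonzero
vectors of `ℝ³`. -/
instance RP2.instTopologicalSpace : TopologicalSpace RP2 :=
  TopologicalSpace.coinduced (Projectivization.mk' ℝ : {v : Fin 3 → ℝ // v ≠ 0} → RP2)
    inferInstance

/-- A projective line: the set of points of `RP2` in some two-dimensional linear subspace. -/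
def IsProjLine (L : Set RP2) : Prop :=
  ∃ W : Submodule ℝ (Fin 3 → ℝ), Module.finrank ℝ W = 2 ∧ L = {x : RP2 | x.submodule ≤ W}

/-- `s` is a (closed) projective line segment joining `p` and `q`. Two distinct points are joined by
exactly two segments, obtained from `u, v` and from `u, -v`, where `u` and `v` represent
`p` and `q`; if `p = q` then `s = {p}`. -/
def IsProjSegment (p q : RP2) (s : Set RP2) : Prop :=
  ∃ (u v : Fin 3 → ℝ) (hu : u ≠ 0) (hv : v ≠ 0),
    Projectivization.mk ℝ u hu = p ∧ Projectivization.mk ℝ v hv = q ∧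
    s = {x : RP2 | ∃ a b : ℝ, 0 ≤ a ∧ 0 ≤ b ∧
      ∃ h : a • u + b • v ≠ 0, x = Projectivization.mk ℝ (a • u + b • v) h}

/-- Any two points of `X` can be joined by a segment contained in `X`. -/
def IsSemiconvex (X : Set RP2) : Prop :=
  ∀ p ∈ X, ∀ q ∈ X, ∃ s : Set RP2, IsProjSegment p q s ∧ s ⊆ X

/-- A convex subset of `RP2`: it is semiconvex and is contained in an affine plane, that is, in the
complement of a projective line. -/
def IsProjConvex (X : Set RP2) : Prop :=
  IsSemiconvex X ∧ ∃ L : Set RP2, IsProjLine L ∧ X ⊆ Lᶜ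

/-- A projective convex hull of `Y`: an inclusion-wise minimal convex set containing `Y`. -/
def IsProjConvexHull (Y X : Set RP2) : Prop :=
  Minimal (fun Z : Set RP2 => IsProjConvex Z ∧ Y ⊆ Z) X

/-- A projective `k`-gon determined by `S`: a projective convex hull of a set `I` of `k` points
of `S` that has all points of `I` on its boundary. -/
def IsProjGon (k : ℕ) (S : Set RP2) (X : Set RP2) : Prop :=
  ∃ I : Finset RP2, (I : Set RP2) ⊆ S ∧ I.card = k ∧
    IsProjConvexHull (I : Set RP2) X ∧ (I : Set RP2) ⊆ frontier X

/-- A projective `k`-hole in `S`: a projective `k`-gon determined by `S` with no point of `S` in its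
interior. -/
def IsProjHole (k : ℕ) (S : Set RP2) (X : Set RP2) : Prop :=
  IsProjGon k S X ∧ ∀ p ∈ S, p ∉ interior X

/-- The number of projective `k`-holes in `S`. -/
def numProjHoles (k : ℕ) (S : Set RP2) : ℕ :=
  {X : Set RP2 | IsProjHole k S X}.ncard

theorem homogenize_ne_zero (x : Plane) : (![x 0, x 1, 1] : Fin 3 → ℝ) ≠ 0 := fun h =>
  one_ne_zero (α := ℝ) (by simpa using congrFun h 2)

/-- The standard embedding of the plane in `RP2`, sending `(x, y)` to `[x : y : 1]`. -/
def toRP2 (x : Plane) : RP2 :=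
  Projectivization.mk ℝ ![x 0, x 1, 1] (homogenize_ne_zero x)

end

/-! Every affine hole is a projective hole contained in the affine plane, so it is enough to produce
enough projective holes that meet the line at infinity. Projective hulls are handled as images of
convex cones in ℝ³ over signed representatives (`isProjConvexHull_projCone`, `exists_projCone_eq`).
The segment joining `p` and `q` through infinity is then the cone over `homogenize p` and
`-homogenize q`.

For triangles, any further point spans with this segment a projective triangle. Repeatedly replacing
the third vertex by a point of `P` inside makes the triangle empty. Each such hole contains exactly
three points of `P`, so it comes from at most 6 of the n(n-1) ordered pairs. This gives at least
C(n,2)/3 new holes.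

For quadrilaterals, the segment through infinity serves as a diagonal. If some line through two
other points leaves `p` and `q` on the same side, Cramer's relation yields a convex projective
quadrilateral with that diagonal, and shrinking its two triangles makes it empty
(`exists_isEmptyQuad`). Such a hole and the vertex `p` determine `q`
(`IsEmptyQuad.eq_of_same_first`), so each hole comes from at most 4 ordered pairs. The remaining
pairs are those separated by every line through two other points. As segments, any two of them
without a common endpoint cross, and the Hopf–Pannwitz argument for such geometric graphs bounds
their number by n (`card_separatedPair_le`). Hence there are at least (C(n,2) - n)/2 new holes,
which is enough for n ≥ 2. -/

/-! ### Projective cones and convex hulls -/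

/-- The projective image of the convex cone generated by `V`. -/
def projCone (V : Set (Fin 3 → ℝ)) : Set RP2 :=
  {x | ∃ w ∈ Submodule.span NNReal V, ∃ h : w ≠ 0, x = Projectivization.mk ℝ w h}

theorem pos_of_mem_span {V : Set (Fin 3 → ℝ)} {f : (Fin 3 → ℝ) →ₗ[ℝ] ℝ}
    (hf : ∀ v ∈ V, 0 < f v) {w : Fin 3 → ℝ} (hw : w ∈ Submodule.span NNReal V) (h0 : w ≠ 0) :
    0 < f w := by
  have key : w = 0 ∨ 0 < f w := by
    clear h0
    induction hw using Submodule.span_induction with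
    | mem x hx => exact Or.inr (hf x hx)
    | zero => exact Or.inl rfl
    | add x y _ _ hx hy =>
      rcases hx with rfl | hx <;> rcases hy with rfl | hy <;> simp_all
      right; linarith
    | smul a x _ hx =>
      rcases hx with rfl | hx
      · simp
      · rcases eq_or_ne a 0 with rfl | ha
        · simp
        · right
          rw [NNReal.smul_def, map_smul, smul_eq_mul]
          exact mul_pos (NNReal.coe_pos.2 (pos_iff_ne_zero.2 ha)) hx
  exact key.resolve_left h0

theorem smul_mem_span {V : Set (Fin 3 → ℝ)} {w : Fin 3 → ℝ}
    (hw : w ∈ Submodule.span NNReal V) {a : ℝ} (ha : 0 ≤ a) : a • w ∈ Submodule.span NNReal V :=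
  Submodule.smul_mem (Submodule.span NNReal V) (⟨a, ha⟩ : NNReal) hw

theorem smul_mem_span_of_mem {V : Set (Fin 3 → ℝ)} {v : Fin 3 → ℝ} (hv : v ∈ V)
    {a : ℝ} (ha : 0 ≤ a) : a • v ∈ Submodule.span NNReal V :=
  smul_mem_span (Submodule.subset_span hv) ha

theorem projCone_mono {V V' : Set (Fin 3 → ℝ)} (h : ∀ v ∈ V, v ∈ Submodule.span NNReal V') :
    projCone V ⊆ projCone V' := by
  rintro x ⟨w, hw, h0, rfl⟩
  exact ⟨w, Submodule.span_le.2 h hw, h0, rfl⟩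

theorem mk_mem_projCone {V : Set (Fin 3 → ℝ)} {w : Fin 3 → ℝ} (h : w ≠ 0) :
    Projectivization.mk ℝ w h ∈ projCone V ↔
      ∃ c : ℝ, c ≠ 0 ∧ c • w ∈ Submodule.span NNReal V := by
  constructor
  · rintro ⟨w', hw', h', heq⟩
    obtain ⟨a, ha⟩ := (Projectivization.mk_eq_mk_iff' ℝ _ _ h h').1 heq
    have ha0 : a ≠ 0 := by rintro rfl; exact h (by simpa using ha.symm)
    exact ⟨a⁻¹, inv_ne_zero ha0, by rw [← ha, inv_smul_smul₀ ha0]; exact hw'⟩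
  · rintro ⟨c, hc, hw⟩
    exact ⟨c • w, hw, smul_ne_zero hc h,
      (Projectivization.mk_eq_mk_iff' ℝ _ _ _ _).2 ⟨c⁻¹, inv_smul_smul₀ hc w⟩⟩

theorem isSemiconvex_projCone (V : Set (Fin 3 → ℝ)) : IsSemiconvex (projCone V) := by
  rintro p ⟨u, hu, hu0, rfl⟩ q ⟨v, hv, hv0, rfl⟩
  refine ⟨_, ⟨u, v, hu0, hv0, rfl, rfl, rfl⟩, ?_⟩
  rintro x ⟨a, b, ha, hb, h, rfl⟩
  exact ⟨_, add_mem (smul_mem_span hu ha) (smul_mem_span hv hb), h, rfl⟩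

theorem isProjLine_ker {f : (Fin 3 → ℝ) →ₗ[ℝ] ℝ} (hf : f ≠ 0) :
    IsProjLine {x : RP2 | x.submodule ≤ LinearMap.ker f} := by
  refine ⟨LinearMap.ker f, ?_, rfl⟩
  have h1 := f.finrank_range_add_finrank_ker
  have h2 : Module.finrank ℝ (LinearMap.range f) = 1 := by
    rw [LinearMap.range_eq_top.2 (LinearMap.surjective hf)]; simp
  simp at h1
  omega

theorem mk_submodule_le_ker {f : (Fin 3 → ℝ) →ₗ[ℝ] ℝ} {w : Fin 3 → ℝ} (h : w ≠ 0) :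
    (Projectivization.mk ℝ w h).submodule ≤ LinearMap.ker f ↔ f w = 0 := by
  rw [Projectivization.submodule_mk, Submodule.span_singleton_le_iff_mem, LinearMap.mem_ker]

theorem isProjConvex_projCone {V : Set (Fin 3 → ℝ)} {f : (Fin 3 → ℝ) →ₗ[ℝ] ℝ} (hf0 : f ≠ 0)
    (hf : ∀ v ∈ V, 0 < f v) : IsProjConvex (projCone V) := by
  refine ⟨isSemiconvex_projCone V, _, isProjLine_ker hf0, ?_⟩
  rintro x ⟨w, hw, h0, rfl⟩ hx
  exact (pos_of_mem_span hf hw h0).ne' ((mk_submodule_le_ker h0).1 hx)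

/-- One of the two segments between the points, the one spanned by `x` and `-y`, crosses the line `f
= 0`. Since `Z` avoids that line, it must contain the other segment, which passes through `x + y`.
-/
theorem mk_mem_of_mk_mem {f : (Fin 3 → ℝ) →ₗ[ℝ] ℝ} {Z : Set RP2}
    (hZ : IsSemiconvex Z) (hZf : ∀ w, ∀ h : w ≠ 0, Projectivization.mk ℝ w h ∈ Z → f w ≠ 0)
    {x y : Fin 3 → ℝ} (hx0 : x ≠ 0) (hy0 : y ≠ 0) (hxy : x + y ≠ 0) (hx : 0 < f x) (hy : 0 < f y)
    (hxZ : Projectivization.mk ℝ x hx0 ∈ Z) (hyZ : Projectivization.mk ℝ y hy0 ∈ Z) :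
    Projectivization.mk ℝ (x + y) hxy ∈ Z := by
  obtain ⟨s, ⟨u, v, hu, hv, hux, hvy, rfl⟩, hs⟩ := hZ _ hxZ _ hyZ
  obtain ⟨α, rfl⟩ := (Projectivization.mk_eq_mk_iff' ℝ _ _ _ _).1 hux
  obtain ⟨β, rfl⟩ := (Projectivization.mk_eq_mk_iff' ℝ _ _ _ _).1 hvy
  have hα : α ≠ 0 := by rintro rfl; simp at hu
  have hβ : β ≠ 0 := by rintro rfl; simp at hv
  rcases lt_or_gt_of_ne (mul_ne_zero hα hβ) with hneg | hpos
  · have hab : ∃ a b : ℝ, 0 ≤ a ∧ 0 ≤ b ∧ 0 < |a| ∧ a * α * f x + b * β * f y = 0 := by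
      refine ⟨|β| * f y, |α| * f x, by positivity, by positivity, by positivity, ?_⟩
      rcases lt_or_gt_of_ne hα with h | h
      · have h' : 0 < β := by nlinarith
        rw [abs_of_neg h, abs_of_pos h']; ring
      · have h' : β < 0 := by nlinarith
        rw [abs_of_pos h, abs_of_neg h']; ring
    obtain ⟨a, b, ha, hb, ha0, hab⟩ := hab
    -- If the crossing vector vanishes, `x` and `y` are proportional, and `x + y` represents the
    -- same point as `y`.
    by_cases hz : a • α • x + b • β • y = 0
    · have haα : a * α ≠ 0 := mul_ne_zero (abs_pos.1 ha0) hα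
      have hxe : x = (-(b * β) / (a * α)) • y := by
        have : (a * α) • x = (-(b * β)) • y := by
          rw [neg_smul, eq_neg_iff_add_eq_zero, ← hz, smul_smul, smul_smul]
        rw [div_eq_inv_mul, mul_smul, ← this, inv_smul_smul₀ haα]
      convert hyZ using 1
      refine (Projectivization.mk_eq_mk_iff' ℝ _ _ _ _).2 ⟨-(b * β) / (a * α) + 1, ?_⟩
      rw [add_smul, ← hxe, one_smul]
    · exact absurd (by simpa [mul_assoc] using hab)
        (hZf _ hz (hs ⟨a, b, ha, hb, hz, rfl⟩))
  · refine hs ⟨|α|⁻¹, |β|⁻¹, by positivity, by positivity, ?_⟩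
    rcases lt_or_gt_of_ne hα with h | h
    · have h' : β < 0 := by nlinarith
      have e : |α|⁻¹ • α • x + |β|⁻¹ • β • y = -(x + y) := by
        rw [abs_of_neg h, abs_of_neg h', smul_smul, smul_smul, inv_neg, inv_neg, neg_mul, neg_mul,
          inv_mul_cancel₀ hα, inv_mul_cancel₀ hβ]
        simp [add_comm]
      refine ⟨by rw [e]; exact neg_ne_zero.2 hxy, ?_⟩
      exact (Projectivization.mk_eq_mk_iff' ℝ _ _ _ _).2 ⟨-1, by rw [e]; simp [add_comm]⟩
    · have h' : 0 < β := by nlinarith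
      have e : |α|⁻¹ • α • x + |β|⁻¹ • β • y = x + y := by
        rw [abs_of_pos h, abs_of_pos h', inv_smul_smul₀ hα, inv_smul_smul₀ hβ]
      refine ⟨by rw [e]; exact hxy, ?_⟩
      simp only [e]

theorem projCone_subset {V : Set (Fin 3 → ℝ)} {f : (Fin 3 → ℝ) →ₗ[ℝ] ℝ}
    (hf : ∀ v ∈ V, 0 < f v) {Z : Set RP2} (hZ : IsSemiconvex Z)
    (hZf : ∀ w, ∀ h : w ≠ 0, Projectivization.mk ℝ w h ∈ Z → f w ≠ 0)
    (hV : ∀ v ∈ V, ∀ h : v ≠ 0, Projectivization.mk ℝ v h ∈ Z) : projCone V ⊆ Z := by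
  rintro _ ⟨w, hw, h0, rfl⟩
  have key : ∀ h : w ≠ 0, Projectivization.mk ℝ w h ∈ Z := by
    clear h0
    induction hw using Submodule.span_induction with
    | mem x hx => exact hV x hx
    | zero => exact fun h => absurd rfl h
    | add x y hxV hyV hx hy =>
      intro h
      rcases eq_or_ne x 0 with rfl | hx0
      · simpa using hy (by simpa using h)
      rcases eq_or_ne y 0 with rfl | hy0
      · simpa using hx (by simpa using h)
      exact mk_mem_of_mk_mem hZ hZf hx0 hy0 h (pos_of_mem_span hf hxV hx0)
        (pos_of_mem_span hf hyV hy0) (hx hx0) (hy hy0)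
    | smul a x _ hx =>
      intro h
      have hx0 : x ≠ 0 := by rintro rfl; simp at h
      convert hx hx0 using 1
      exact (Projectivization.mk_eq_mk_iff' ℝ _ _ _ _).2 ⟨(a : ℝ), rfl⟩
  exact key h0

theorem projCone_missing {V : Set (Fin 3 → ℝ)} {f : (Fin 3 → ℝ) →ₗ[ℝ] ℝ}
    (hf : ∀ v ∈ V, 0 < f v) (w : Fin 3 → ℝ) (h : w ≠ 0)
    (hw : Projectivization.mk ℝ w h ∈ projCone V) : f w ≠ 0 := by
  obtain ⟨c, hc, hcw⟩ := (mk_mem_projCone h).1 hw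
  have := pos_of_mem_span hf hcw (smul_ne_zero hc h)
  rintro h0
  simp [h0] at this

/-- The projective cone over positive vectors is a convex hull of its generators. -/
theorem isProjConvexHull_projCone {V : Set (Fin 3 → ℝ)} {f : (Fin 3 → ℝ) →ₗ[ℝ] ℝ} (hf0 : f ≠ 0)
    (hf : ∀ v ∈ V, 0 < f v) {Y : Set RP2} (hY : Y ⊆ projCone V)
    (hV : ∀ v ∈ V, ∀ h : v ≠ 0, Projectivization.mk ℝ v h ∈ Y) :
    IsProjConvexHull Y (projCone V) := by
  refine ⟨⟨isProjConvex_projCone hf0 hf, hY⟩, fun Z hZ hle => ?_⟩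
  -- A competitor `Z` inside the cone misses the line `f = 0` because the cone does.
  exact projCone_subset hf hZ.1.1 (fun w h hw => projCone_missing hf w h (hle hw))
    (fun v hv h => hZ.2 (hV v hv h))

/-- Every projective convex hull is the projective cone over suitable signed representatives. -/
theorem exists_projCone_eq {Y X : Set RP2} (h : IsProjConvexHull Y X) :
    ∃ V : Set (Fin 3 → ℝ), V ⊆ {v | ∃ y ∈ Y, v = y.rep ∨ v = -y.rep} ∧ X = projCone V := by
  obtain ⟨L, ⟨W, hW, rfl⟩, hXL⟩ := h.1.1.2
  have hlt : W < ⊤ := by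
    refine lt_top_iff_ne_top.2 ?_
    rintro rfl
    simp at hW
  obtain ⟨f, hf0, hWf⟩ := W.exists_le_ker_of_lt_top hlt
  have hWe : W = LinearMap.ker f := by
    refine Submodule.eq_of_le_of_finrank_eq hWf ?_
    obtain ⟨W', hW', he⟩ := isProjLine_ker hf0
    have h1 := f.finrank_range_add_finrank_ker
    have h2 : Module.finrank ℝ (LinearMap.range f) = 1 := by
      rw [LinearMap.range_eq_top.2 (LinearMap.surjective hf0)]; simp
    simp at h1
    omega
  have hXf : ∀ w, ∀ h : w ≠ 0, Projectivization.mk ℝ w h ∈ X → f w ≠ 0 := by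
    intro w hw hwX h0
    refine hXL hwX ?_
    rw [hWe]
    exact (mk_submodule_le_ker hw).2 h0
  -- The line missed by `X` is `f = 0`; it selects the sign of each representative.
  let V : Set (Fin 3 → ℝ) := {v | (∃ y ∈ Y, v = y.rep ∨ v = -y.rep) ∧ 0 < f v}
  have hVY : ∀ v ∈ V, ∀ h : v ≠ 0, Projectivization.mk ℝ v h ∈ Y := by
    rintro v ⟨⟨y, hy, hv⟩, -⟩ h
    convert hy
    conv_rhs => rw [← y.mk_rep]
    refine (Projectivization.mk_eq_mk_iff' ℝ _ _ _ _).2 ?_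
    rcases hv with rfl | rfl
    · exact ⟨1, one_smul _ _⟩
    · exact ⟨-1, by simp⟩
  have hYV : Y ⊆ projCone V := by
    intro y hy
    have h1 : f y.rep ≠ 0 := hXf y.rep y.rep_nonzero (by rw [y.mk_rep]; exact h.1.2 hy)
    rw [← y.mk_rep]
    rcases lt_or_gt_of_ne h1 with h1 | h1
    · refine (mk_mem_projCone _).2 ⟨-1, by norm_num, Submodule.subset_span ?_⟩
      exact ⟨⟨y, hy, Or.inr (by simp)⟩, by simpa using h1⟩
    · refine (mk_mem_projCone _).2 ⟨1, by norm_num, Submodule.subset_span ?_⟩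
      exact ⟨⟨y, hy, Or.inl (by simp)⟩, by simpa using h1⟩
  refine ⟨V, fun v hv => hv.1, Set.Subset.antisymm ?_ ?_⟩
  · refine h.2 ⟨isProjConvex_projCone hf0 fun v hv => hv.2, hYV⟩ ?_
    exact projCone_subset (fun v hv => hv.2) h.1.1.1 hXf fun v hv h' => h.1.2 (hVY v hv h')
  · exact projCone_subset (fun v hv => hv.2) h.1.1.1 hXf fun v hv h' => h.1.2 (hVY v hv h')

/-- Finiteness is needed because `Set.ncard` is 0 on infinite sets. It holds because there are only
finitely many sets of signed representatives. -/
theorem finite_isProjHole (k : ℕ) {S : Set RP2} (hS : S.Finite) :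
    {X : Set RP2 | IsProjHole k S X}.Finite := by
  have hR : {v : Fin 3 → ℝ | ∃ y ∈ S, v = y.rep ∨ v = -y.rep}.Finite := by
    refine ((hS.image fun y => y.rep).union (hS.image fun y => -y.rep)).subset ?_
    rintro v ⟨y, hy, rfl | rfl⟩
    · exact Or.inl ⟨y, hy, rfl⟩
    · exact Or.inr ⟨y, hy, rfl⟩
  refine (hR.finite_subsets.image projCone).subset ?_
  rintro X ⟨⟨I, hI, -, hX, -⟩, -⟩
  obtain ⟨V, hV, rfl⟩ := exists_projCone_eq hX
  refine ⟨V, fun v hv => ?_, rfl⟩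
  obtain ⟨y, hy, h⟩ := hV hv
  exact ⟨y, hI hy, h⟩

/-! ### Supporting planes and interiors -/

/-- A generator that lies on a supporting plane is not interior. -/
theorem mk_notMem_interior {V : Set (Fin 3 → ℝ)} {f g : (Fin 3 → ℝ) →ₗ[ℝ] ℝ}
    (hf : ∀ v ∈ V, 0 < f v) (hg0 : g ≠ 0) (hg : ∀ v ∈ V, 0 ≤ g v) {v : Fin 3 → ℝ} (h : v ≠ 0)
    (hfv : 0 < f v) (hgv : g v = 0) : Projectivization.mk ℝ v h ∉ interior (projCone V) := by
  intro hint
  -- Moving from `v` along `u` gives `g < 0` for every t > 0. For small t the form `f` stays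
  -- positive, so the opposite representative cannot lie in the cone either.
  obtain ⟨u, hu⟩ := LinearMap.surjective hg0 (-1)
  have hne : ∀ t : ℝ, v + t • u ≠ 0 := by
    intro t ht
    have h1 : g (v + t • u) = 0 := by rw [ht, map_zero]
    have h2 : t = 0 := by simpa [hgv, hu] using h1
    rw [h2] at ht
    exact h (by simpa using ht)
  have hc : Continuous fun t : ℝ => Projectivization.mk' ℝ (⟨v + t • u, hne t⟩ : {w : Fin 3 → ℝ // w ≠ 0}) := by
    have h1 : Continuous (Projectivization.mk' ℝ : {v : Fin 3 → ℝ // v ≠ 0} → RP2) :=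
      continuous_coinduced_rng
    exact h1.comp (Continuous.subtype_mk (by fun_prop) _)
  have ho := isOpen_interior.preimage (t := interior (projCone V)) hc
  have h0 : (0 : ℝ) ∈ (fun t : ℝ => Projectivization.mk' ℝ
      (⟨v + t • u, hne t⟩ : {w : Fin 3 → ℝ // w ≠ 0})) ⁻¹' interior (projCone V) := by
    simpa [Projectivization.mk'_eq_mk] using hint
  have hfc : Filter.Tendsto (fun t : ℝ => f v + t * f u) (nhds 0) (nhds (f v)) := by
    have : Continuous fun t : ℝ => f v + t * f u := by fun_prop
    simpa using this.tendsto 0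
  have hev := (Filter.eventually_mem_set.2 (ho.mem_nhds h0)).and (hfc.eventually_const_lt hfv)
  obtain ⟨t, ⟨ht1, ht2⟩, ht⟩ := ((hev.filter_mono nhdsWithin_le_nhds).and
    (self_mem_nhdsWithin (s := Set.Ioi (0 : ℝ)))).exists
  have ht3 : Projectivization.mk ℝ (v + t • u) (hne t) ∈ projCone V := interior_subset ht1
  obtain ⟨c, hc0, hcw⟩ := (mk_mem_projCone (hne t)).1 ht3
  have h4 : 0 < f (c • (v + t • u)) := pos_of_mem_span hf hcw (smul_ne_zero hc0 (hne t))
  have hcpos : 0 < c := by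
    have : 0 < c * (f v + t * f u) := by simpa [mul_add] using h4
    exact pos_of_mul_pos_left this ht2.le
  have h5 : 0 ≤ g (c • (v + t • u)) := by
    generalize c • (v + t • u) = w at hcw
    induction hcw using Submodule.span_induction with
    | mem x hx => exact hg x hx
    | zero => simp
    | add x y _ _ hx hy => rw [map_add]; exact add_nonneg hx hy
    | smul a x _ hx =>
      rw [NNReal.smul_def, map_smul]
      exact mul_nonneg a.2 hx
  have h6 : 0 ≤ c * (t * (-1)) := by simpa [hgv, hu] using h5
  have : 0 < c * t := mul_pos hcpos ht
  linarith

/-! ### Homogeneous coordinates and affine holes -/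

/-- Homogeneous coordinates of a point of the plane. -/
def homogenize (x : Plane) : Fin 3 → ℝ := ![x 0, x 1, 1]

theorem homogenize_ne (x : Plane) : homogenize x ≠ 0 := homogenize_ne_zero x

@[simp] theorem homogenize_two (x : Plane) : homogenize x 2 = 1 := rfl

theorem homogenize_injective : Function.Injective homogenize := by
  intro x y h
  ext i
  fin_cases i
  · exact congrFun h 0
  · exact congrFun h 1

theorem eq_of_smul_homogenize_eq {c : ℝ} {x y : Plane} (h : c • homogenize x = homogenize y) :
    x = y := by
  have h1 : c = 1 := by simpa using congrFun h 2
  rw [h1, one_smul] at h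
  exact homogenize_injective h

theorem eq_of_smul_homogenize_eq_smul {c d : ℝ} {x y : Plane} (hd : d ≠ 0)
    (h : c • homogenize x = d • homogenize y) : x = y := by
  apply eq_of_smul_homogenize_eq (c := d⁻¹ * c)
  rw [mul_smul, h, inv_smul_smul₀ hd]

theorem toRP2_injective : Function.Injective toRP2 := by
  intro x y h
  obtain ⟨a, ha⟩ := (Projectivization.mk_eq_mk_iff' ℝ _ _ (homogenize_ne x) (homogenize_ne y)).1 h
  exact (eq_of_smul_homogenize_eq ha).symm

theorem continuous_toRP2 : Continuous toRP2 := by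
  have h1 : Continuous (Projectivization.mk' ℝ : {v : Fin 3 → ℝ // v ≠ 0} → RP2) :=
    continuous_coinduced_rng
  refine h1.comp (f := fun x : Plane => (⟨homogenize x, homogenize_ne x⟩ : {v : Fin 3 → ℝ // v ≠ 0}))
    (Continuous.subtype_mk ?_ _)
  refine continuous_pi fun i => ?_
  fin_cases i <;> simp [homogenize] <;> fun_prop

theorem toRP2_mem_projCone {V : Set (Fin 3 → ℝ)} {x : Plane} :
    toRP2 x ∈ projCone V ↔ ∃ c : ℝ, c ≠ 0 ∧ c • homogenize x ∈ Submodule.span NNReal V :=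
  mk_mem_projCone _

theorem smul_add_smul_homogenize {a b : ℝ} (hab : a + b ≠ 0) (x y : Plane) :
    a • homogenize x + b • homogenize y =
      (a + b) • homogenize ((a / (a + b)) • x + (b / (a + b)) • y) := by
  ext i
  fin_cases i <;> simp [homogenize] <;> field_simp

theorem toRP2_image_convexHull (I : Set Plane) :
    toRP2 '' convexHull ℝ I = projCone (homogenize '' I) := by
  apply Set.Subset.antisymm
  · have key : convexHull ℝ I ⊆
        {x | homogenize x ∈ Submodule.span NNReal (homogenize '' I)} := by
      refine convexHull_min (fun x hx => Submodule.subset_span ⟨x, hx, rfl⟩) ?_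
      intro x hx y hy a b ha hb hab
      have := smul_add_smul_homogenize (a := a) (b := b) (by rw [hab]; norm_num) x y
      simp only [hab, div_one, one_smul] at this
      rw [Set.mem_ofPred_eq, ← this]
      exact add_mem (smul_mem_span hx ha) (smul_mem_span hy hb)
    rintro _ ⟨x, hx, rfl⟩
    exact toRP2_mem_projCone.2 ⟨1, one_ne_zero, by rw [one_smul]; exact key hx⟩
  · rintro _ ⟨w, hw, h0, rfl⟩
    -- The third coordinate of a cone vector is the total weight `c`; dividing by it gives a convex
    -- combination.
    have key : w = 0 ∨ ∃ c : ℝ, 0 < c ∧ ∃ x ∈ convexHull ℝ I, w = c • homogenize x := by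
      clear h0
      induction hw using Submodule.span_induction with
      | mem w hw =>
        obtain ⟨x, hx, rfl⟩ := hw
        exact Or.inr ⟨1, one_pos, x, subset_convexHull ℝ I hx, (one_smul _ _).symm⟩
      | zero => exact Or.inl rfl
      | add u v _ _ hu hv =>
        rcases hu with rfl | ⟨a, ha, x, hx, rfl⟩
        · simpa using hv
        rcases hv with rfl | ⟨b, hb, y, hy, rfl⟩
        · exact Or.inr ⟨a, ha, x, hx, by simp⟩
        · have hab : 0 < a + b := add_pos ha hb
          refine Or.inr ⟨a + b, hab, _, ?_, smul_add_smul_homogenize hab.ne' x y⟩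
          refine convex_convexHull ℝ I hx hy (by positivity) (by positivity) ?_
          field_simp
      | smul a v _ hv =>
        rcases hv with rfl | ⟨b, hb, y, hy, rfl⟩
        · simp
        · rcases eq_or_ne a 0 with rfl | ha
          · simp
          · refine Or.inr ⟨a * b, mul_pos (NNReal.coe_pos.2 (pos_iff_ne_zero.2 ha)) hb, y, hy, ?_⟩
            rw [NNReal.smul_def, mul_smul]
    obtain ⟨c, hc, x, hx, rfl⟩ := key.resolve_left h0
    exact ⟨x, hx, (Projectivization.mk_eq_mk_iff' ℝ _ _ _ _).2 ⟨c⁻¹, inv_smul_smul₀ hc.ne' _⟩⟩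

/-- Pulling an interior back along the continuous injective map `toRP2` keeps it inside the interior
of the polygon. The vertices are on the frontier because they belong to `S`, none of whose points is
interior. -/
theorem isProjHole_image_of_isAffineHole {k : ℕ} {S Q : Set Plane} (h : IsAffineHole k S Q) :
    IsProjHole k (toRP2 '' S) (toRP2 '' Q) := by
  classical
  obtain ⟨⟨I, hIS, hIk, -, rfl⟩, hint⟩ := h
  have hint' : ∀ p ∈ toRP2 '' S, p ∉ interior (toRP2 '' convexHull ℝ (I : Set Plane)) := by
    rintro _ ⟨p, hp, rfl⟩ hpi
    refine hint p hp (interior_maximal ?_ (isOpen_interior.preimage continuous_toRP2) hpi)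
    intro x hx
    obtain ⟨y, hy, hxy⟩ := interior_subset hx
    rwa [← toRP2_injective hxy]
  have hIX : toRP2 '' (I : Set Plane) ⊆ toRP2 '' convexHull ℝ (I : Set Plane) :=
    Set.image_mono (subset_convexHull ℝ _)
  refine ⟨⟨I.image toRP2, ?_, ?_, ?_, ?_⟩, hint'⟩
  · rw [Finset.coe_image]; exact Set.image_mono hIS
  · rw [Finset.card_image_of_injective _ toRP2_injective, hIk]
  · rw [Finset.coe_image]
    rw [toRP2_image_convexHull] at hIX ⊢
    refine isProjConvexHull_projCone (f := LinearMap.proj 2) ?_ ?_ hIX ?_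
    · intro h
      have := LinearMap.congr_fun h (homogenize 0)
      simp at this
    · rintro _ ⟨x, -, rfl⟩
      simp
    · rintro _ ⟨x, hx, rfl⟩ _
      exact ⟨x, hx, rfl⟩
  · rw [Finset.coe_image]
    intro x hx
    exact ⟨subset_closure (hIX hx), hint' x (Set.image_mono hIS hx)⟩

/-! ### Triple products and general position -/

/-- The triple product, as a linear form in the third vector. -/
def triple (u v : Fin 3 → ℝ) : (Fin 3 → ℝ) →ₗ[ℝ] ℝ where
  toFun w := (u 1 * v 2 - u 2 * v 1) * w 0 + (u 2 * v 0 - u 0 * v 2) * w 1 +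
    (u 0 * v 1 - u 1 * v 0) * w 2
  map_add' x y := by simp; ring
  map_smul' c x := by simp; ring

theorem triple_apply (u v w : Fin 3 → ℝ) : triple u v w =
    (u 1 * v 2 - u 2 * v 1) * w 0 + (u 2 * v 0 - u 0 * v 2) * w 1 +
    (u 0 * v 1 - u 1 * v 0) * w 2 := rfl

@[simp] theorem triple_self_left (u v : Fin 3 → ℝ) : triple u v u = 0 := by
  rw [triple_apply]; ring

@[simp] theorem triple_self_right (u v : Fin 3 → ℝ) : triple u v v = 0 := by
  rw [triple_apply]; ring

theorem triple_rotate (u v w : Fin 3 → ℝ) : triple v w u = triple u v w := by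
  simp only [triple_apply]; ring

theorem triple_swap (u v w : Fin 3 → ℝ) : triple v u w = -triple u v w := by
  simp only [triple_apply]; ring

/-- This is the dependence among four vectors of ℝ³, with `p, q` on one side and `r, s` on the
other. The signs of its coefficients decide which signed representatives form a quadrilateral with
diagonal `pq`. -/
theorem triple_cramer (p q r s : Fin 3 → ℝ) :
    triple q r s • p - triple p r s • q = -triple p q s • r + triple p q r • s := by
  ext i
  fin_cases i <;> simp [triple_apply] <;> ring

theorem coeffs_eq_zero {u v w : Fin 3 → ℝ} (h : triple u v w ≠ 0) {a b c : ℝ}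
    (h0 : a • u + b • v + c • w = 0) : a = 0 ∧ b = 0 ∧ c = 0 := by
  have h1 : triple v w u ≠ 0 := by rwa [triple_rotate]
  have h2 : triple w u v ≠ 0 := by rwa [triple_rotate, triple_rotate]
  have e1 := congrArg (triple v w) h0
  have e2 := congrArg (triple w u) h0
  have e3 := congrArg (triple u v) h0
  simp [h, h1, h2] at e1 e2 e3
  exact ⟨e1, e2, e3⟩

theorem collinear_of_triple_eq_zero {p q r : Plane}
    (h : triple (homogenize p) (homogenize q) (homogenize r) = 0) : Collinear ℝ {p, q, r} := by
  by_cases hpq : p = q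
  · subst hpq
    simpa using collinear_pair ℝ p r
  have h' : (q 0 - p 0) * (r 1 - p 1) = (q 1 - p 1) * (r 0 - p 0) := by
    simp [triple_apply, homogenize] at h
    linarith
  have key : ∃ t : ℝ, r = t • (q - p) + p := by
    by_cases h0 : q 0 - p 0 = 0
    · have h1 : q 1 - p 1 ≠ 0 := by
        intro h1
        apply hpq
        ext i
        fin_cases i
        · simp; linarith
        · simp; linarith
      refine ⟨(r 1 - p 1) / (q 1 - p 1), ?_⟩
      have h2 : r 0 - p 0 = 0 := by
        rw [h0, zero_mul] at h'
        exact (mul_eq_zero.1 h'.symm).resolve_left h1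
      ext i
      fin_cases i
      · simp [h0]; linarith
      · simp; field_simp; ring
    · refine ⟨(r 0 - p 0) / (q 0 - p 0), ?_⟩
      ext i
      fin_cases i
      · simp; field_simp; ring
      · simp; field_simp; linarith
  obtain ⟨t, ht⟩ := key
  refine (collinear_iff_of_mem (p₀ := p) (by simp)).2 ⟨q - p, ?_⟩
  intro x hx
  simp only [Set.mem_insert_iff, Set.mem_singleton_iff] at hx
  rcases hx with rfl | rfl | rfl
  · exact ⟨0, by simp⟩
  · exact ⟨1, by simp⟩
  · exact ⟨t, by simpa using ht⟩

theorem InGeneralPosition.triple_ne_zero {S : Set Plane} (hS : InGeneralPosition S) {p q r : Plane}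
    (hp : p ∈ S) (hq : q ∈ S) (hr : r ∈ S) (hpq : p ≠ q) (hpr : p ≠ r) (hqr : q ≠ r) :
    triple (homogenize p) (homogenize q) (homogenize r) ≠ 0 := fun h =>
  hS p hp q hq r hr hpq hpr hqr (collinear_of_triple_eq_zero h)

theorem mem_span_triple_nnreal {u v w x : Fin 3 → ℝ} :
    x ∈ Submodule.span NNReal {u, v, w} ↔
      ∃ a b c : ℝ, 0 ≤ a ∧ 0 ≤ b ∧ 0 ≤ c ∧ x = a • u + b • v + c • w := by
  constructor
  · intro h
    obtain ⟨a, y, hy, rfl⟩ := Submodule.mem_span_insert.1 h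
    obtain ⟨b, c, rfl⟩ := Submodule.mem_span_pair.1 hy
    exact ⟨a, b, c, a.2, b.2, c.2, by simp only [NNReal.smul_def, add_assoc]⟩
  · rintro ⟨a, b, c, ha, hb, hc, rfl⟩
    exact add_mem (add_mem (smul_mem_span_of_mem (by simp) ha) (smul_mem_span_of_mem (by simp) hb))
      (smul_mem_span_of_mem (by simp) hc)

theorem mem_span_quadruple_nnreal {u v w z x : Fin 3 → ℝ}
    (h : x ∈ Submodule.span NNReal {u, v, w, z}) :
    ∃ a b c d : ℝ, 0 ≤ a ∧ 0 ≤ b ∧ 0 ≤ c ∧ 0 ≤ d ∧ x = a • u + b • v + c • w + d • z := by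
  obtain ⟨a, y, hy, rfl⟩ := Submodule.mem_span_insert.1 h
  obtain ⟨b, c, d, hb, hc, hd, rfl⟩ := mem_span_triple_nnreal.1 hy
  exact ⟨a, b, c, d, a.2, hb, hc, hd, by simp only [NNReal.smul_def, add_assoc]⟩

/-! ### Empty projective triangles and supports -/

variable {P : Finset Plane}

/-- Every triangle with side through infinity contains an empty one with the same side. -/
theorem exists_empty_triangle (hP : InGeneralPosition (P : Set Plane)) {p q : Plane} (hp : p ∈ P)
    (hq : q ∈ P) (hpq : p ≠ q) {r₀ : Plane} (hr₀ : r₀ ∈ P) (hrp₀ : r₀ ≠ p) (hrq₀ : r₀ ≠ q) {c₀ : ℝ}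
    (hc₀ : c₀ ≠ 0) :
    ∃ r ∈ P, r ≠ p ∧ r ≠ q ∧ ∃ c : ℝ, c ≠ 0 ∧
      c • homogenize r ∈
        Submodule.span NNReal {homogenize p, -homogenize q, c₀ • homogenize r₀} ∧
      ∀ s ∈ P, toRP2 s ∈ projCone {homogenize p, -homogenize q, c • homogenize r} →
        s = p ∨ s = q ∨ s = r := by
  classical
  -- Induction on the number of points of `P` in the triangle: a further point `s` replaces `r₀`,
  -- and `r₀` itself drops out.
  induction hn : (P.filter fun s => toRP2 s ∈
    projCone {homogenize p, -homogenize q, c₀ • homogenize r₀}).card using Nat.strong_induction_on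
    generalizing r₀ c₀ with
  | _ n ih =>
  by_cases hemp : ∀ s ∈ P, toRP2 s ∈ projCone {homogenize p, -homogenize q, c₀ • homogenize r₀} →
        s = p ∨ s = q ∨ s = r₀
  · exact ⟨r₀, hr₀, hrp₀, hrq₀, c₀, hc₀, Submodule.subset_span (by simp), hemp⟩
  push Not at hemp
  obtain ⟨s, hs, hsX, hsp, hsq, hsr⟩ := hemp
  obtain ⟨c, hc, hcs⟩ := toRP2_mem_projCone.1 hsX
  have hsub : ∀ v ∈ ({homogenize p, -homogenize q, c • homogenize s} : Set (Fin 3 → ℝ)),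
      v ∈ Submodule.span NNReal {homogenize p, -homogenize q, c₀ • homogenize r₀} := by
    simp only [Set.mem_insert_iff, Set.mem_singleton_iff]
    rintro v (rfl | rfl | rfl)
    · exact Submodule.subset_span (by simp)
    · exact Submodule.subset_span (by simp)
    · exact hcs
  have hD := hP.triple_ne_zero hp hq hr₀ hpq hrp₀.symm hrq₀.symm
  have hnot : toRP2 r₀ ∉ projCone {homogenize p, -homogenize q, c • homogenize s} := by
    intro hr
    obtain ⟨k, hk, hkr⟩ := toRP2_mem_projCone.1 hr
    obtain ⟨a, b, g, ha, hb, hg, e1⟩ := mem_span_triple_nnreal.1 hcs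
    obtain ⟨a', b', g', ha', hb', hg', e2⟩ := mem_span_triple_nnreal.1 hkr
    rw [e1] at e2
    have e3 : (a' + g' * a) • homogenize p + (-(b' + g' * b)) • homogenize q +
        (g' * g * c₀ - k) • homogenize r₀ = 0 := by
      rw [sub_smul, e2]; module
    -- Sums of nonnegative coefficients vanish, so `s` has no `p` or `q` component and coincides
    -- with `r₀`.
    obtain ⟨h1, h2, h3⟩ := coeffs_eq_zero hD e3
    have hg'0 : g' ≠ 0 := by
      rintro rfl
      apply hk
      linarith
    have hga := mul_nonneg hg' ha
    have hgb := mul_nonneg hg' hb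
    have ha0 : a = 0 := (mul_eq_zero.1 (by linarith : g' * a = 0)).resolve_left hg'0
    have hb0 : b = 0 := (mul_eq_zero.1 (by linarith : g' * b = 0)).resolve_left hg'0
    rw [ha0, hb0, zero_smul, zero_smul, zero_add, zero_add, smul_smul] at e1
    exact hsr (eq_of_smul_homogenize_eq_smul hc e1.symm).symm
  have hlt : (P.filter fun x => toRP2 x ∈
      projCone {homogenize p, -homogenize q, c • homogenize s}).card < n := by
    rw [← hn]
    refine Finset.card_lt_card (Finset.ssubset_iff_of_subset ?_ |>.2 ⟨r₀, ?_, ?_⟩)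
    · intro x hx
      rw [Finset.mem_filter] at hx ⊢
      exact ⟨hx.1, projCone_mono hsub hx.2⟩
    · rw [Finset.mem_filter]
      exact ⟨hr₀, toRP2_mem_projCone.2 ⟨c₀, hc₀, Submodule.subset_span (by simp)⟩⟩
    · rw [Finset.mem_filter]
      exact fun h => hnot h.2
  obtain ⟨r, hr, hrp, hrq, d, hd, hdr, h⟩ := ih _ hlt hs hsp hsq hc rfl
  exact ⟨r, hr, hrp, hrq, d, hd, Submodule.span_le.2 hsub hdr, h⟩

/-- A projective cone over signed representatives of points of `P`, with a supporting plane
through each of them and no further point of `P`, is a hole. -/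
theorem isProjHole_projCone {k : ℕ} {V : Set (Fin 3 → ℝ)} {f : (Fin 3 → ℝ) →ₗ[ℝ] ℝ} (hf0 : f ≠ 0)
    (hf : ∀ v ∈ V, 0 < f v) {I : Finset Plane} (hIP : I ⊆ P) (hIk : I.card = k)
    (hIV : ∀ x ∈ I, ∃ c : ℝ, c ≠ 0 ∧ c • homogenize x ∈ V)
    (hVI : ∀ v ∈ V, ∃ x ∈ I, ∃ c : ℝ, v = c • homogenize x)
    (hg : ∀ v ∈ V, ∃ g : (Fin 3 → ℝ) →ₗ[ℝ] ℝ, g ≠ 0 ∧ g v = 0 ∧ ∀ u ∈ V, 0 ≤ g u)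
    (hPI : ∀ s ∈ P, toRP2 s ∈ projCone V → s ∈ I) :
    IsProjHole k (toRP2 '' (P : Set Plane)) (projCone V) := by
  classical
  have hmk : ∀ x : Plane, ∀ c : ℝ, ∀ h : c • homogenize x ≠ 0,
      Projectivization.mk ℝ (c • homogenize x) h = toRP2 x := fun x c h =>
    (Projectivization.mk_eq_mk_iff' ℝ _ _ _ _).2 ⟨c, rfl⟩
  have hint : ∀ x ∈ I, toRP2 x ∉ interior (projCone V) := by
    intro x hx
    obtain ⟨c, hc, hcV⟩ := hIV x hx
    obtain ⟨g, hg0, hgv, hgV⟩ := hg _ hcV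
    rw [← hmk x c (smul_ne_zero hc (homogenize_ne x))]
    exact mk_notMem_interior hf hg0 hgV _ (hf _ hcV) hgv
  have hIX : ((I.image toRP2 : Finset RP2) : Set RP2) ⊆ projCone V := by
    rw [Finset.coe_image]
    rintro _ ⟨x, hx, rfl⟩
    obtain ⟨c, hc, hcV⟩ := hIV x hx
    exact toRP2_mem_projCone.2 ⟨c, hc, Submodule.subset_span hcV⟩
  refine ⟨⟨I.image toRP2, ?_, ?_, ?_, ?_⟩, ?_⟩
  · rw [Finset.coe_image]; exact Set.image_mono hIP
  · rw [Finset.card_image_of_injective _ toRP2_injective, hIk]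
  · refine isProjConvexHull_projCone hf0 hf hIX ?_
    intro v hv h
    obtain ⟨x, hx, c, rfl⟩ := hVI v hv
    rw [hmk, Finset.coe_image]
    exact ⟨x, hx, rfl⟩
  · intro y hy
    refine ⟨subset_closure (hIX hy), ?_⟩
    rw [Finset.coe_image] at hy
    obtain ⟨x, hx, rfl⟩ := hy
    exact hint x hx
  · rintro _ ⟨s, hs, rfl⟩ hsi
    exact hint s (hPI s hs (interior_subset hsi)) hsi

/-- `X` is not contained in the affine plane. -/
def MeetsInfinity (X : Set RP2) : Prop := ∃ y ∈ X, y ∉ Set.range toRP2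

/-- The sum of the two generators has third coordinate 1 - 1 = 0: it is the point at infinity of the
line `pq`. -/
theorem meetsInfinity_projCone {p q : Plane} (hpq : p ≠ q) {V : Set (Fin 3 → ℝ)}
    (hp : homogenize p ∈ V) (hq : -homogenize q ∈ V) : MeetsInfinity (projCone V) := by
  have h0 : homogenize p + -homogenize q ≠ 0 := by
    intro h
    exact hpq (homogenize_injective (add_neg_eq_zero.1 h))
  refine ⟨_, ⟨_, add_mem (Submodule.subset_span hp) (Submodule.subset_span hq), h0, rfl⟩, ?_⟩
  rintro ⟨x, hx⟩
  obtain ⟨a, ha⟩ := (Projectivization.mk_eq_mk_iff' ℝ _ _ (homogenize_ne x) h0).1 hx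
  have := congrFun ha 2
  simp at this

/-- The planes through two generators support the cone, and their sum is positive on all three. The
factor `δ` makes the forms independent of orientation. -/
theorem triangle_supports {v₁ v₂ v₃ : Fin 3 → ℝ} (h : triple v₁ v₂ v₃ ≠ 0) :
    (∃ f : (Fin 3 → ℝ) →ₗ[ℝ] ℝ, f ≠ 0 ∧ ∀ v ∈ ({v₁, v₂, v₃} : Set (Fin 3 → ℝ)), 0 < f v) ∧
    ∀ v ∈ ({v₁, v₂, v₃} : Set (Fin 3 → ℝ)), ∃ g : (Fin 3 → ℝ) →ₗ[ℝ] ℝ, g ≠ 0 ∧ g v = 0 ∧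
      ∀ u ∈ ({v₁, v₂, v₃} : Set (Fin 3 → ℝ)), 0 ≤ g u := by
  set δ := triple v₁ v₂ v₃ with hδ
  have h' : triple v₂ v₃ v₁ = δ := triple_rotate _ _ _
  have h'' : triple v₃ v₁ v₂ = δ := by rw [triple_rotate, triple_rotate]
  have hpos : 0 < δ * δ := mul_self_pos.2 h
  have ne : ∀ {g : (Fin 3 → ℝ) →ₗ[ℝ] ℝ} {v}, 0 < g v → g ≠ 0 := by
    rintro g v hv rfl
    simp at hv
  have e1 : (δ • triple v₁ v₂) v₃ = δ * δ := rfl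
  have e2 : (δ • triple v₃ v₁) v₂ = δ * δ := by rw [LinearMap.smul_apply, h'', smul_eq_mul]
  simp only [Set.mem_insert_iff, Set.mem_singleton_iff, forall_eq_or_imp, forall_eq]
  refine ⟨⟨δ • triple v₁ v₂ + δ • triple v₂ v₃ + δ • triple v₃ v₁, ?_, ?_, ?_, ?_⟩,
    ⟨δ • triple v₁ v₂, ne (hpos.trans_eq e1.symm), ?_, ?_, ?_, ?_⟩,
    ⟨δ • triple v₁ v₂, ne (hpos.trans_eq e1.symm), ?_, ?_, ?_, ?_⟩,
    ⟨δ • triple v₃ v₁, ne (hpos.trans_eq e2.symm), ?_, ?_, ?_, ?_⟩⟩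
  · apply ne (v := v₁)
    simpa [h'] using h
  all_goals simp [h', h'', ← hδ, h, hpos.le]

/-- By the relation, the diagonals `v₁v₂` and `v₃v₄` cross. The opposite sides `v₁v₃` (form `g₁`)
and `v₂v₄` (form `g₂`) together pass through all four vertices, and each form is positive on the
other side's vertices. Hence these two forms give all the supports, and their sum gives `f`. -/
theorem quadrangle_supports {v₁ v₂ v₃ v₄ : Fin 3 → ℝ} (h : triple v₁ v₂ v₃ ≠ 0) {a b : ℝ}
    (ha : 0 < a) (hb : 0 < b) (hab : a • v₁ + b • v₂ = v₃ + v₄) :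
    (∃ f : (Fin 3 → ℝ) →ₗ[ℝ] ℝ, f ≠ 0 ∧ ∀ v ∈ ({v₁, v₂, v₃, v₄} : Set (Fin 3 → ℝ)), 0 < f v) ∧
    ∀ v ∈ ({v₁, v₂, v₃, v₄} : Set (Fin 3 → ℝ)), ∃ g : (Fin 3 → ℝ) →ₗ[ℝ] ℝ, g ≠ 0 ∧ g v = 0 ∧
      ∀ u ∈ ({v₁, v₂, v₃, v₄} : Set (Fin 3 → ℝ)), 0 ≤ g u := by
  have h4 : v₄ = a • v₁ + b • v₂ - v₃ := eq_sub_of_add_eq' hab.symm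
  set δ := triple v₁ v₂ v₃ with hδ
  have hpos : 0 < δ * δ := mul_self_pos.2 h
  have ne : ∀ {g : (Fin 3 → ℝ) →ₗ[ℝ] ℝ} {v}, 0 < g v → g ≠ 0 := by
    rintro g v hv rfl
    simp at hv
  set g₁ := -(δ • triple v₁ v₃) with hg₁
  set g₂ := -(δ • triple v₂ v₄) with hg₂
  have e11 : g₁ v₁ = 0 := by simp [hg₁]
  have e12 : g₁ v₂ = δ * δ := by
    simp only [hg₁, hδ, LinearMap.neg_apply, LinearMap.smul_apply, smul_eq_mul, triple_apply]; ring
  have e13 : g₁ v₃ = 0 := by simp [hg₁]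
  have e14 : g₁ v₄ = b * (δ * δ) := by
    rw [h4, map_sub, map_add, map_smul, map_smul, e11, e12, e13]; simp
  have e22 : g₂ v₂ = 0 := by simp [hg₂]
  have e24 : g₂ v₄ = 0 := by simp [hg₂]
  have e21 : g₂ v₁ = δ * δ := by
    simp only [hg₂, h4, hδ, LinearMap.neg_apply, LinearMap.smul_apply, smul_eq_mul, triple_apply,
      Pi.sub_apply, Pi.add_apply, Pi.smul_apply]
    ring
  have e23 : g₂ v₃ = a * (δ * δ) := by
    have : v₃ = a • v₁ + b • v₂ - v₄ := by rw [h4]; abel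
    rw [this, map_sub, map_add, map_smul, map_smul, e21, e22, e24]; simp
  have hb' := mul_pos hb hpos
  have ha' := mul_pos ha hpos
  simp only [Set.mem_insert_iff, Set.mem_singleton_iff, forall_eq_or_imp, forall_eq]
  refine ⟨⟨g₁ + g₂, ?_, ?_, ?_, ?_, ?_⟩, ⟨g₁, ne (e12 ▸ hpos), ?_⟩, ⟨g₂, ne (e21 ▸ hpos), ?_⟩,
    ⟨g₁, ne (e12 ▸ hpos), ?_⟩, ⟨g₂, ne (e21 ▸ hpos), ?_⟩⟩
  · apply ne (v := v₁)
    rw [LinearMap.add_apply, e11, e21, zero_add]; exact hpos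
  all_goals simp only [LinearMap.add_apply, e11, e12, e13, e14, e21, e22, e23, e24]
  all_goals simp only [zero_add, add_zero, le_refl, true_and, and_true]
  all_goals first | assumption | exact ⟨hpos.le, hb'.le⟩ | exact ⟨hpos.le, ha'.le⟩

theorem triple_vertices_ne_zero (hP : InGeneralPosition (P : Set Plane)) {p q r : Plane}
    (hp : p ∈ P) (hq : q ∈ P) (hr : r ∈ P) (hpq : p ≠ q) (hrp : r ≠ p) (hrq : r ≠ q) {c : ℝ}
    (hc : c ≠ 0) : triple (homogenize p) (-homogenize q) (c • homogenize r) ≠ 0 := by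
  have h1 := hP.triple_ne_zero hp hq hr hpq hrp.symm hrq.symm
  have h2 : triple (homogenize p) (-homogenize q) (c • homogenize r) =
      -c * triple (homogenize p) (homogenize q) (homogenize r) := by
    simp only [triple_apply, Pi.neg_apply, Pi.smul_apply, smul_eq_mul]; ring
  rw [h2]
  exact mul_ne_zero (neg_ne_zero.2 hc) h1

theorem card_triple {p q r : Plane} (hpq : p ≠ q) (hrp : r ≠ p) (hrq : r ≠ q) :
    ({p, q, r} : Finset Plane).card = 3 :=
  Finset.card_eq_three.2 ⟨p, q, r, hpq, hrp.symm, hrq.symm, rfl⟩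

/-- Each ordered pair is a side through infinity of an empty projective triangle. -/
theorem exists_projHole_three (hP : InGeneralPosition (P : Set Plane)) (hP3 : 3 ≤ P.card)
    {p q : Plane} (hp : p ∈ P) (hq : q ∈ P) (hpq : p ≠ q) :
    ∃ X : Set RP2, IsProjHole 3 (toRP2 '' (P : Set Plane)) X ∧ MeetsInfinity X ∧
      ∃ I : Finset Plane, I.card = 3 ∧ (∀ s ∈ P, toRP2 s ∈ X ↔ s ∈ I) ∧ I ⊆ P ∧ p ∈ I ∧ q ∈ I := by
  classical
  obtain ⟨r₀, hr₀, hr₀'⟩ := Finset.exists_mem_notMem_of_card_lt_card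
    (s := {p, q}) (t := P) (by rw [Finset.card_pair hpq]; omega)
  simp only [Finset.mem_insert, Finset.mem_singleton, not_or] at hr₀'
  obtain ⟨r, hr, hrp, hrq, c, hc, -, hemp⟩ :=
    exists_empty_triangle hP hp hq hpq hr₀ hr₀'.1 hr₀'.2 one_ne_zero
  obtain ⟨⟨f, hf0, hf⟩, hg⟩ := triangle_supports
    (triple_vertices_ne_zero hP hp hq hr hpq hrp hrq hc)
  have hIV : ∀ x ∈ ({p, q, r} : Finset Plane), ∃ d : ℝ, d ≠ 0 ∧ d • homogenize x ∈
      ({homogenize p, -homogenize q, c • homogenize r} : Set (Fin 3 → ℝ)) := by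
    simp only [Finset.mem_insert, Finset.mem_singleton, forall_eq_or_imp, forall_eq]
    exact ⟨⟨1, by simp⟩, ⟨-1, by simp⟩, ⟨c, hc, by simp⟩⟩
  have hIP : ({p, q, r} : Finset Plane) ⊆ P := by
    simp [Finset.insert_subset_iff, hp, hq, hr]
  have hPI : ∀ s ∈ P, toRP2 s ∈ projCone {homogenize p, -homogenize q, c • homogenize r} →
      s ∈ ({p, q, r} : Finset Plane) := by simpa using hemp
  refine ⟨_, isProjHole_projCone hf0 hf hIP (card_triple hpq hrp hrq) hIV ?_ hg hPI,
    meetsInfinity_projCone hpq (by simp) (by simp), {p, q, r}, card_triple hpq hrp hrq, ?_, hIP,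
    by simp, by simp⟩
  · simp only [Set.mem_insert_iff, Set.mem_singleton_iff, forall_eq_or_imp, forall_eq]
    exact ⟨⟨p, by simp, 1, by simp⟩, ⟨q, by simp, -1, by simp⟩, ⟨r, by simp, c, rfl⟩⟩
  · refine fun s hs => ⟨hPI s hs, fun hsI => ?_⟩
    obtain ⟨d, hd, hdV⟩ := hIV s hsI
    exact toRP2_mem_projCone.2 ⟨d, hd, Submodule.subset_span hdV⟩

/-! ### Empty projective quadrilaterals -/

/-- The diagonal `uv` cuts the quadrilateral into two triangles: the relation eliminates whichever
of `w`, `z` has the smaller coefficient. -/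
theorem mem_span_or_mem_span {u v w z x : Fin 3 → ℝ} {a b : ℝ} (ha : 0 ≤ a) (hb : 0 ≤ b)
    (hab : a • u + b • v = w + z) (hx : x ∈ Submodule.span NNReal {u, v, w, z}) :
    x ∈ Submodule.span NNReal {u, v, w} ∨ x ∈ Submodule.span NNReal {u, v, z} := by
  obtain ⟨α, β, γ, δ, hα, hβ, hγ, hδ, rfl⟩ := mem_span_quadruple_nnreal hx
  rcases le_total δ γ with h | h
  · refine Or.inl (mem_span_triple_nnreal.2 ⟨α + δ * a, β + δ * b, γ - δ, by positivity,
      by positivity, sub_nonneg.2 h, ?_⟩)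
    have hz : z = a • u + b • v - w := by rw [hab]; abel
    rw [hz]; module
  · refine Or.inr (mem_span_triple_nnreal.2 ⟨α + γ * a, β + γ * b, δ - γ, by positivity,
      by positivity, sub_nonneg.2 h, ?_⟩)
    have hw : w = a • u + b • v - z := by rw [hab]; abel
    rw [hw]; module

/-- `X` is a projective quadrilateral with vertices `p, r, q, r'` in this order, the diagonal `pq`
passing through infinity, that contains no further point of `P`. -/
structure IsEmptyQuad (P : Finset Plane) (p q r r' : Plane) (X : Set RP2) : Prop where
  p_mem : p ∈ P
  q_mem : q ∈ P
  r_mem : r ∈ P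
  r'_mem : r' ∈ P
  p_ne_q : p ≠ q
  r_ne_p : r ≠ p
  r_ne_q : r ≠ q
  r'_ne_p : r' ≠ p
  r'_ne_q : r' ≠ q
  r_ne_r' : r ≠ r'
  exists_cone : ∃ a b c c' : ℝ, 0 < a ∧ 0 < b ∧ c ≠ 0 ∧ c' ≠ 0 ∧
    a • homogenize p + b • -homogenize q = c • homogenize r + c' • homogenize r' ∧
    X = projCone {homogenize p, -homogenize q, c • homogenize r, c' • homogenize r'}
  mem_iff : ∀ s ∈ P, toRP2 s ∈ X ↔ s ∈ ({p, q, r, r'} : Finset Plane)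

theorem IsEmptyQuad.symm {p q r r' : Plane} {X : Set RP2} (h : IsEmptyQuad P p q r r' X) :
    IsEmptyQuad P p q r' r X where
  p_mem := h.p_mem
  q_mem := h.q_mem
  r_mem := h.r'_mem
  r'_mem := h.r_mem
  p_ne_q := h.p_ne_q
  r_ne_p := h.r'_ne_p
  r_ne_q := h.r'_ne_q
  r'_ne_p := h.r_ne_p
  r'_ne_q := h.r_ne_q
  r_ne_r' := h.r_ne_r'.symm
  exists_cone := by
    obtain ⟨a, b, c, c', ha, hb, hc, hc', hab, hX⟩ := h.exists_cone
    refine ⟨a, b, c', c, ha, hb, hc', hc, by rw [hab, add_comm], ?_⟩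
    rw [hX, Set.pair_comm (c • homogenize r)]
  mem_iff s hs := by
    rw [h.mem_iff s hs, Finset.pair_comm r]

theorem IsEmptyQuad.isProjHole (hP : InGeneralPosition (P : Set Plane)) {p q r r' : Plane}
    {X : Set RP2} (h : IsEmptyQuad P p q r r' X) :
    IsProjHole 4 (toRP2 '' (P : Set Plane)) X ∧ MeetsInfinity X := by
  obtain ⟨a, b, c, c', ha, hb, hc, hc', hab, rfl⟩ := h.exists_cone
  obtain ⟨⟨f, hf0, hf⟩, hg⟩ := quadrangle_supports
    (triple_vertices_ne_zero hP h.p_mem h.q_mem h.r_mem h.p_ne_q h.r_ne_p h.r_ne_q hc) ha hb hab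
  refine ⟨isProjHole_projCone (I := {p, q, r, r'}) hf0 hf ?_ ?_ ?_ ?_ hg
    fun s hs => (h.mem_iff s hs).1, meetsInfinity_projCone h.p_ne_q (by simp) (by simp)⟩
  · simp [Finset.insert_subset_iff, h.p_mem, h.q_mem, h.r_mem, h.r'_mem]
  · exact Finset.card_eq_succ.2 ⟨p, {q, r, r'}, by simp [h.p_ne_q, h.r_ne_p.symm, h.r'_ne_p.symm],
      rfl, Finset.card_eq_three.2 ⟨q, r, r', h.r_ne_q.symm, h.r'_ne_q.symm, h.r_ne_r', rfl⟩⟩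
  · simp only [Finset.mem_insert, Finset.mem_singleton, forall_eq_or_imp, forall_eq]
    exact ⟨⟨1, by simp⟩, ⟨-1, by simp⟩, ⟨c, hc, by simp⟩, ⟨c', hc', by simp⟩⟩
  · simp only [Set.mem_insert_iff, Set.mem_singleton_iff, forall_eq_or_imp, forall_eq]
    exact ⟨⟨p, by simp, 1, by simp⟩, ⟨q, by simp, -1, by simp⟩, ⟨r, by simp, c, rfl⟩,
      ⟨r', by simp, c', rfl⟩⟩

/-- A vertex of an empty quadrilateral cannot be joined to a neighbour by a diagonal. -/
theorem IsEmptyQuad.not_adjacent (hP : InGeneralPosition (P : Set Plane)) {p q r r' : Plane}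
    {X : Set RP2} (h₁ : IsEmptyQuad P p q r r' X) (h₂ : IsEmptyQuad P p r q r' X) : False := by
  obtain ⟨a, b, c, c', ha, hb, hc, hc', hab, hX⟩ := h₁.exists_cone
  obtain ⟨a₂, b₂, d, d', ha₂, hb₂, -, -, hab₂, hX₂⟩ := h₂.exists_cone
  have hr : triple (homogenize q) (homogenize r') (homogenize r) ≠ 0 :=
    hP.triple_ne_zero h₁.q_mem h₁.r'_mem h₁.r_mem h₁.r'_ne_q.symm h₁.r_ne_q.symm h₁.r_ne_r'.symm
  have e1 := congrArg (triple (homogenize q) (homogenize r')) hab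
  have e2 := congrArg (triple (homogenize q) (homogenize r')) hab₂
  simp only [map_add, map_smul, map_neg, triple_self_left, triple_self_right, smul_eq_mul] at e1 e2
  -- Applying the triple product with `q` and `r'` to both relations leaves only `p` and `r`.
  -- Comparing them gives `a₂ * c = a * b₂`.
  have hcpos : 0 < c := by
    have h3 : (a₂ * c) * triple (homogenize q) (homogenize r') (homogenize r) =
        (a * b₂) * triple (homogenize q) (homogenize r') (homogenize r) := by
      linear_combination a * e2 - a₂ * e1
    have h4 := mul_right_cancel₀ hr h3
    have h5 := mul_pos ha hb₂
    rw [← h4] at h5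
    exact pos_of_mul_pos_right h5 ha₂.le
  obtain ⟨⟨f, -, hf⟩, -⟩ := quadrangle_supports
    (triple_vertices_ne_zero hP h₁.p_mem h₁.q_mem h₁.r_mem h₁.p_ne_q h₁.r_ne_p h₁.r_ne_q hc)
    ha hb hab
  have hfp : 0 < f (homogenize p) := hf _ (by simp)
  have hfr : 0 < f (homogenize r) := by
    have : 0 < f (c • homogenize r) := hf _ (by simp)
    rw [map_smul, smul_eq_mul] at this
    exact pos_of_mul_pos_right this hcpos.le
  -- The segment from `p` to `r` through infinity lies in `X` by `h₂`. It contains this point of the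
  -- line `f = 0`, which `X` misses by `h₁`.
  have hne : f (homogenize r) • homogenize p + f (homogenize p) • -homogenize r ≠ 0 := by
    intro h0
    rw [smul_neg, add_neg_eq_zero] at h0
    exact h₁.r_ne_p (eq_of_smul_homogenize_eq_smul hfp.ne' h0).symm
  have hmem : Projectivization.mk ℝ _ hne ∈ X := by
    rw [hX₂]
    exact ⟨_, add_mem (smul_mem_span_of_mem (by simp) hfr.le)
      (smul_mem_span_of_mem (by simp) hfp.le), hne, rfl⟩
  rw [hX] at hmem
  refine projCone_missing hf _ hne hmem ?_
  simp only [map_add, map_smul, map_neg, smul_eq_mul]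
  ring

/-- Otherwise each of `q`, `q₂` is a neighbour of `p` with respect to the other diagonal. Both
descriptions have the same four vertices, so `IsEmptyQuad.not_adjacent` applies. -/
theorem IsEmptyQuad.eq_of_same_first (hP : InGeneralPosition (P : Set Plane))
    {p q r r' q₂ t t' : Plane} {X : Set RP2} (h₁ : IsEmptyQuad P p q r r' X)
    (h₂ : IsEmptyQuad P p q₂ t t' X) : q = q₂ := by
  by_contra hne
  have hq₂ : q₂ = r ∨ q₂ = r' := by
    have := (h₁.mem_iff q₂ h₂.q_mem).1 ((h₂.mem_iff q₂ h₂.q_mem).2 (by simp))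
    simpa [h₂.p_ne_q.symm, Ne.symm hne] using this
  have hq : q = t ∨ q = t' := by
    have := (h₂.mem_iff q h₁.q_mem).1 ((h₁.mem_iff q h₁.q_mem).2 (by simp))
    simpa [h₁.p_ne_q.symm, hne] using this
  have key : ∀ {s s'}, IsEmptyQuad P p q q₂ s X → IsEmptyQuad P p q₂ q s' X → False := by
    intro s s' h h'
    have hs : s' = s := by
      have := (h.mem_iff s' h'.r'_mem).1 ((h'.mem_iff s' h'.r'_mem).2 (by simp))
      simpa [h'.r'_ne_p, h'.r'_ne_q, h'.r_ne_r'.symm] using this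
    subst hs
    exact h.not_adjacent hP h'
  rcases hq₂ with rfl | rfl <;> rcases hq with rfl | rfl
  · exact key h₁ h₂
  · exact key h₁ h₂.symm
  · exact key h₁.symm h₂
  · exact key h₁.symm h₂.symm

/-- If `p` and `q` lie on the same side of the line `r r'`, the segment `pq` through infinity is a
diagonal of an empty projective quadrilateral. -/
theorem exists_isEmptyQuad (hP : InGeneralPosition (P : Set Plane)) {p q r r' : Plane}
    (hp : p ∈ P) (hq : q ∈ P) (hr : r ∈ P) (hr' : r' ∈ P) (hpq : p ≠ q) (hrp : r ≠ p) (hrq : r ≠ q)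
    (hrp' : r' ≠ p) (hrq' : r' ≠ q)
    (hside : 0 < triple (homogenize p) (homogenize r) (homogenize r') *
      triple (homogenize q) (homogenize r) (homogenize r')) :
    ∃ t t' X, IsEmptyQuad P p q t t' X := by
  have hD := hP.triple_ne_zero hp hq hr hpq hrp.symm hrq.symm
  have hD' := hP.triple_ne_zero hp hq hr' hpq hrp'.symm hrq'.symm
  -- In Cramer's relation the coefficients of `p` and `-q` have the same sign by `hside`; if both
  -- are negative, the whole relation is negated.
  obtain ⟨a, b, c, c', ha, hb, hc, hc', hab⟩ : ∃ a b c c' : ℝ, 0 < a ∧ 0 < b ∧ c ≠ 0 ∧ c' ≠ 0 ∧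
      a • homogenize p + b • -homogenize q = c • homogenize r + c' • homogenize r' := by
    have hcr := triple_cramer (homogenize p) (homogenize q) (homogenize r) (homogenize r')
    rcases pos_and_pos_or_neg_and_neg_of_mul_pos hside with ⟨h1, h2⟩ | ⟨h1, h2⟩
    · refine ⟨_, _, _, _, h2, h1, neg_ne_zero.2 hD', hD, ?_⟩
      rw [← hcr]; module
    · refine ⟨_, _, _, _, neg_pos.2 h2, neg_pos.2 h1, hD', neg_ne_zero.2 hD, ?_⟩
      rw [← neg_inj, neg_add, neg_add, ← neg_smul, ← neg_smul, ← neg_smul, ← neg_smul, neg_neg,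
        neg_neg, neg_neg, ← hcr]
      module
  -- The new vertex is scaled so that the old one equals it minus a nonnegative combination of `p`
  -- and `-q`. Substituting this into the relation only increases `a` and `b`, so the diagonals
  -- still cross.
  have shrink : ∀ {r : Plane} {c : ℝ}, r ∈ P → r ≠ p → r ≠ q → c ≠ 0 →
      ∃ t ∈ P, t ≠ p ∧ t ≠ q ∧ ∃ d α β : ℝ, d ≠ 0 ∧ 0 ≤ α ∧ 0 ≤ β ∧
        c • homogenize r = d • homogenize t + α • -homogenize p + β • homogenize q ∧
        ∀ s ∈ P, ∀ k : ℝ, k ≠ 0 → k • homogenize s ∈ Submodule.span NNReal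
          {homogenize p, -homogenize q, d • homogenize t} → s = p ∨ s = q ∨ s = t := by
    intro r c hr hrp hrq hc
    obtain ⟨t, ht, htp, htq, d, hd, hdt, hemp⟩ := exists_empty_triangle hP hp hq hpq hr hrp hrq hc
    obtain ⟨α, β, γ, hα, hβ, hγ, e⟩ := mem_span_triple_nnreal.1 hdt
    have hγ0 : γ ≠ 0 := by
      rintro rfl
      have h0 : α • homogenize p + (-β) • homogenize q + (-d) • homogenize t = 0 := by
        rw [neg_smul d, e]; module
      exact hd (by simpa using
        (coeffs_eq_zero (hP.triple_ne_zero hp hq ht hpq htp.symm htq.symm) h0).2.2)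
    have hγpos : 0 < γ := lt_of_le_of_ne hγ hγ0.symm
    refine ⟨t, ht, htp, htq, γ⁻¹ * d, γ⁻¹ * α, γ⁻¹ * β, mul_ne_zero (inv_ne_zero hγ0) hd,
      by positivity, by positivity, ?_, fun s hs k hk hks => hemp s hs ?_⟩
    · rw [mul_smul, e, mul_smul, mul_smul, ← smul_add, ← smul_add, eq_inv_smul_iff₀ hγ0]
      module
    · refine toRP2_mem_projCone.2 ⟨k, hk, Submodule.span_le.2 ?_ hks⟩
      simp only [Set.insert_subset_iff, Set.singleton_subset_iff, SetLike.mem_coe]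
      refine ⟨Submodule.subset_span (by simp), Submodule.subset_span (by simp), ?_⟩
      rw [mul_smul]
      exact smul_mem_span_of_mem (by simp) (by positivity)
  obtain ⟨t, ht, htp, htq, d, α, β, hd, hα, hβ, e, hemp⟩ := shrink hr hrp hrq hc
  obtain ⟨t', ht', htp', htq', d', α', β', hd', hα', hβ', e', hemp'⟩ := shrink hr' hrp' hrq' hc'
  have hrel : (a + α + α') • homogenize p + (b + β + β') • -homogenize q =
      d • homogenize t + d' • homogenize t' := by
    have : d • homogenize t + d' • homogenize t' = c • homogenize r + c' • homogenize r' +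
        (α + α') • homogenize p + (β + β') • -homogenize q := by
      rw [e, e']; module
    rw [this, ← hab]; module
  have hapos : 0 < a + α + α' := by positivity
  have hbpos : 0 < b + β + β' := by positivity
  refine ⟨t, t', _, hp, hq, ht, ht', hpq, htp, htq, htp', htq', ?_,
    ⟨_, _, d, d', hapos, hbpos, hd, hd', hrel, rfl⟩, fun s hs => ⟨fun hsX => ?_, fun hsI => ?_⟩⟩
  · rintro rfl
    have h0 : (a + α + α') • homogenize p + (-(b + β + β')) • homogenize q +
        (-(d + d')) • homogenize t = 0 := by
      rw [neg_smul (d + d'), add_smul d, ← hrel]; module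
    exact hapos.ne' (coeffs_eq_zero
      (hP.triple_ne_zero hp hq ht hpq htp.symm htq.symm) h0).1
  · obtain ⟨k, hk, hks⟩ := toRP2_mem_projCone.1 hsX
    rcases mem_span_or_mem_span hapos.le hbpos.le hrel hks with h | h
    · have := hemp s hs k hk h
      simp only [Finset.mem_insert, Finset.mem_singleton]; tauto
    · have := hemp' s hs k hk h
      simp only [Finset.mem_insert, Finset.mem_singleton]; tauto
  · have : ∃ k : ℝ, k ≠ 0 ∧ k • homogenize s ∈ ({homogenize p, -homogenize q, d • homogenize t,
        d' • homogenize t'} : Set (Fin 3 → ℝ)) := by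
      simp only [Finset.mem_insert, Finset.mem_singleton] at hsI
      rcases hsI with rfl | rfl | rfl | rfl
      · exact ⟨1, by simp⟩
      · exact ⟨-1, by simp⟩
      · exact ⟨d, hd, by simp⟩
      · exact ⟨d', hd', by simp⟩
    obtain ⟨k, hk, hks⟩ := this
    exact toRP2_mem_projCone.2 ⟨k, hk, Submodule.subset_span hks⟩

/-! ### Separated pairs -/

/-- Every line through two further points of `P` separates `p` from `q`. -/
def SeparatedPair (P : Finset Plane) (p q : Plane) : Prop :=
  ∀ r ∈ P, ∀ r' ∈ P, r ≠ p → r ≠ q → r' ≠ p → r' ≠ q → r ≠ r' →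
    triple (homogenize p) (homogenize r) (homogenize r') *
      triple (homogenize q) (homogenize r) (homogenize r') < 0

theorem SeparatedPair.symm {p q : Plane} (h : SeparatedPair P p q) : SeparatedPair P q p :=
  fun r hr r' hr' h1 h2 h3 h4 h5 => by
    rw [mul_comm]; exact h r hr r' hr' h2 h1 h4 h3 h5

/-- No separated pair at `p` is to the left of `pq`. -/
def IsLeftmost (P : Finset Plane) (p q : Plane) : Prop :=
  ∀ r ∈ P, r ≠ p → SeparatedPair P p r →
    triple (homogenize p) (homogenize q) (homogenize r) ≤ 0

/-- Otherwise there are separated pairs `pr` and `qs` with `r` and `s` strictly on opposite sides of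
the line `pq`. Separation makes the segments `pr` and `qs` cross, which is impossible since they
meet that line only at `p` and `q`. -/
theorem isLeftmost_or_isLeftmost {p q : Plane} (hp : p ∈ P) (hq : q ∈ P) (hpq : p ≠ q) :
    IsLeftmost P p q ∨ IsLeftmost P q p := by
  by_contra hcon
  rw [not_or] at hcon
  unfold IsLeftmost at hcon
  push Not at hcon
  obtain ⟨⟨r, hr, hrp, hpr, h1⟩, ⟨s, hs, hsq, hqs, h2⟩⟩ := hcon
  have hrq : r ≠ q := by rintro rfl; simp at h1
  have hsp : s ≠ p := by rintro rfl; simp at h2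
  rw [triple_swap] at h2
  have hrs : r ≠ s := by rintro rfl; linarith
  have h3 := hpr q hq s hs hpq.symm hrq.symm hsp hrs.symm hsq.symm
  have h4 := hqs p hp r hr hpq hsp.symm hrq hrs hrp.symm
  rw [triple_swap (homogenize p) (homogenize q)] at h4
  have h5 := pos_of_mul_neg_right h3 (by linarith)
  have h6 := pos_of_mul_neg_right h4 (by linarith)
  -- Additivity of signed areas, valid because all third coordinates are 1. The left side is
  -- positive and the right side negative.
  have h7 : triple (homogenize r) (homogenize q) (homogenize s) +
      triple (homogenize s) (homogenize p) (homogenize r) +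
      triple (homogenize p) (homogenize q) (homogenize r) =
      triple (homogenize p) (homogenize q) (homogenize s) := by
    simp only [triple_apply, homogenize_two]; ring
  linarith

-- Each point is the first end of at most one leftmost separated pair, and every separated pair is
-- leftmost from one of its ends. The factor 2 reflects that pairs are ordered.
open Classical in
theorem card_separatedPair_le (hP : InGeneralPosition (P : Set Plane)) :
    (P.offDiag.filter fun x => SeparatedPair P x.1 x.2).card ≤ 2 * P.card := by
  set B := P.offDiag.filter fun x => SeparatedPair P x.1 x.2 with hB
  set A := B.filter fun x => IsLeftmost P x.1 x.2 with hA
  have hmem : ∀ x : Plane × Plane, x ∈ B ↔ (x.1 ∈ P ∧ x.2 ∈ P ∧ x.1 ≠ x.2) ∧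
      SeparatedPair P x.1 x.2 := fun x => by rw [hB, Finset.mem_filter, Finset.mem_offDiag]
  have hAP : A.card ≤ P.card := by
    refine Finset.card_le_card_of_injOn Prod.fst (fun x hx => ?_) ?_
    · exact ((hmem x).1 (Finset.mem_filter.1 hx).1).1.1
    · rintro ⟨p, q⟩ hx ⟨p', q'⟩ hy (rfl : p = p')
      obtain ⟨hx1, hx2⟩ := Finset.mem_filter.1 hx
      obtain ⟨hy1, hy2⟩ := Finset.mem_filter.1 hy
      obtain ⟨⟨hp, hq, hpq⟩, hs⟩ := (hmem _).1 hx1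
      obtain ⟨⟨-, hq', hpq'⟩, hs'⟩ := (hmem _).1 hy1
      by_contra hne
      have hqq : q ≠ q' := fun h => hne (by rw [h])
      have h0 := hP.triple_ne_zero hp hq hq' hpq hpq' hqq
      have h1 := hx2 q' hq' hpq'.symm hs'
      have h2 := hy2 q hq hpq.symm hs
      rw [← triple_rotate, triple_swap, triple_rotate] at h2
      simp only at h1 h2 h0
      exact h0 (le_antisymm h1 (by linarith))
  have hBA : B ⊆ A ∪ A.image Prod.swap := by
    rintro ⟨p, q⟩ hx
    obtain ⟨⟨hp, hq, hpq⟩, hs⟩ := (hmem _).1 hx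
    rw [Finset.mem_union]
    rcases isLeftmost_or_isLeftmost hp hq hpq with h | h
    · exact Or.inl (Finset.mem_filter.2 ⟨hx, h⟩)
    · refine Or.inr (Finset.mem_image.2 ⟨(q, p), Finset.mem_filter.2 ⟨?_, h⟩, rfl⟩)
      exact (hmem _).2 ⟨⟨hq, hp, hpq.symm⟩, hs.symm⟩
  calc B.card ≤ (A ∪ A.image Prod.swap).card := Finset.card_le_card hBA
    _ ≤ A.card + (A.image Prod.swap).card := Finset.card_union_le _ _
    _ ≤ P.card + P.card := add_le_add hAP (Finset.card_image_le.trans hAP)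
    _ = 2 * P.card := by ring

/-! ### Counting holes -/

open Classical in
/-- Holes that meet the line at infinity come on top of the affine ones. -/
theorem mul_numAffineHoles_add_card_le {k m : ℕ} (P : Finset Plane) (E : Finset (Plane × Plane))
    (F : Plane × Plane → Set RP2)
    (hF : ∀ x ∈ E, IsProjHole k (toRP2 '' (P : Set Plane)) (F x) ∧ MeetsInfinity (F x))
    (hfib : ∀ x ∈ E, (E.filter fun y => F y = F x).card ≤ m) :
    m * numAffineHoles k (P : Set Plane) + E.card ≤
      m * numProjHoles k (toRP2 '' (P : Set Plane)) := by
  have hfin := finite_isProjHole k (P.finite_toSet.image toRP2)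
  have h1 : E.card ≤ m * (E.image F).card := by
    refine Finset.card_le_mul_card_image E m fun X hX => ?_
    obtain ⟨x, hx, rfl⟩ := Finset.mem_image.1 hX
    exact hfib x hx
  set A : Set (Set RP2) := (fun Q => toRP2 '' Q) '' {Q : Set Plane | IsAffineHole k P Q} with hA
  have h2 : A.ncard = numAffineHoles k (P : Set Plane) :=
    Set.ncard_image_of_injective _ toRP2_injective.image_injective
  have hsubA : A ⊆ {X | IsProjHole k (toRP2 '' (P : Set Plane)) X} := by
    rintro _ ⟨Q, hQ, rfl⟩
    exact isProjHole_image_of_isAffineHole hQ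
  have hsubN : ((E.image F : Finset (Set RP2)) : Set (Set RP2)) ⊆
      {X | IsProjHole k (toRP2 '' (P : Set Plane)) X} := by
    intro X hX
    obtain ⟨x, hx, rfl⟩ := Finset.mem_image.1 (Finset.mem_coe.1 hX)
    exact (hF x hx).1
  have hdisj : Disjoint A ((E.image F : Finset (Set RP2)) : Set (Set RP2)) := by
    rw [Set.disjoint_left]
    rintro _ ⟨Q, -, rfl⟩ hX
    obtain ⟨x, hx, hxQ⟩ := Finset.mem_image.1 (Finset.mem_coe.1 hX)
    obtain ⟨y, hy, hy'⟩ := (hF x hx).2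
    rw [hxQ] at hy
    exact hy' (Set.image_subset_range _ _ hy)
  have h3 := Set.ncard_le_ncard (Set.union_subset hsubA hsubN) hfin
  rw [Set.ncard_union_eq hdisj (hfin.subset hsubA) (Finset.finite_toSet _), h2,
    Set.ncard_coe_finset] at h3
  calc m * numAffineHoles k (P : Set Plane) + E.card
      ≤ m * (numAffineHoles k (P : Set Plane) + (E.image F).card) := by rw [mul_add]; omega
    _ ≤ _ := Nat.mul_le_mul_left m h3

/-- All ordered pairs producing the same triangle consist of two of its three points of `P`, so a
fibre has at most 3 · 2 elements. -/
theorem six_mul_numAffineHoles_three_le (hP : InGeneralPosition (P : Set Plane))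
    (hP3 : 3 ≤ P.card) :
    6 * numAffineHoles 3 (P : Set Plane) + P.offDiag.card ≤
      6 * numProjHoles 3 (toRP2 '' (P : Set Plane)) := by
  classical
  have hex : ∀ x : Plane × Plane, ∃ X : Set RP2, x ∈ P.offDiag →
      IsProjHole 3 (toRP2 '' (P : Set Plane)) X ∧ MeetsInfinity X ∧ ∃ I : Finset Plane,
        I.card = 3 ∧ (∀ s ∈ P, toRP2 s ∈ X ↔ s ∈ I) ∧ I ⊆ P ∧ x.1 ∈ I ∧ x.2 ∈ I := by
    intro x
    by_cases hx : x ∈ P.offDiag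
    · obtain ⟨h1, h2, h3⟩ := Finset.mem_offDiag.1 hx
      obtain ⟨X, hX⟩ := exists_projHole_three hP hP3 h1 h2 h3
      exact ⟨X, fun _ => hX⟩
    · exact ⟨∅, fun h => absurd h hx⟩
  choose F hF using hex
  refine mul_numAffineHoles_add_card_le P P.offDiag F (fun x hx => ⟨(hF x hx).1, (hF x hx).2.1⟩) ?_
  intro x hx
  obtain ⟨-, -, I, hI3, hI, -⟩ := hF x hx
  have hsub : (P.offDiag.filter fun y => F y = F x) ⊆ I.offDiag := by
    intro y hy
    obtain ⟨hy, hyx⟩ := Finset.mem_filter.1 hy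
    obtain ⟨h1, h2, h3⟩ := Finset.mem_offDiag.1 hy
    obtain ⟨-, -, J, -, hJ, -, hJ1, hJ2⟩ := hF y hy
    rw [hyx] at hJ
    exact Finset.mem_offDiag.2 ⟨(hI _ h1).1 ((hJ _ h1).2 hJ1), (hI _ h2).1 ((hJ _ h2).2 hJ2), h3⟩
  calc _ ≤ I.offDiag.card := Finset.card_le_card hsub
    _ = 6 := by rw [Finset.offDiag_card, hI3]

/-- Within a fibre the first point determines the pair and is one of the four vertices. The term `2
* P.card` pays for the separated pairs. -/
theorem four_mul_numAffineHoles_four_le (hP : InGeneralPosition (P : Set Plane)) :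
    4 * numAffineHoles 4 (P : Set Plane) + P.offDiag.card ≤
      4 * numProjHoles 4 (toRP2 '' (P : Set Plane)) + 2 * P.card := by
  classical
  set E := P.offDiag.filter fun x => ¬ SeparatedPair P x.1 x.2 with hE
  have hcard : P.offDiag.card ≤ E.card + 2 * P.card := by
    rw [← Finset.card_filter_add_card_filter_not (s := P.offDiag)
      (fun x => SeparatedPair P x.1 x.2), add_comm]
    exact Nat.add_le_add_left (card_separatedPair_le hP) _
  have hex : ∀ x : Plane × Plane, ∃ X : Set RP2, x ∈ E →
      ∃ t t', IsEmptyQuad P x.1 x.2 t t' X := by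
    intro x
    by_cases hx : x ∈ E
    · obtain ⟨hx, hsep⟩ := Finset.mem_filter.1 hx
      obtain ⟨hp, hq, hpq⟩ := Finset.mem_offDiag.1 hx
      unfold SeparatedPair at hsep
      push Not at hsep
      obtain ⟨r, hr, r', hr', h1, h2, h3, h4, h5, h6⟩ := hsep
      have h7 := mul_ne_zero (hP.triple_ne_zero hp hr hr' h1.symm h3.symm h5)
        (hP.triple_ne_zero hq hr hr' h2.symm h4.symm h5)
      obtain ⟨t, t', X, hX⟩ := exists_isEmptyQuad hP hp hq hr hr' hpq h1 h2 h3 h4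
        (lt_of_le_of_ne h6 h7.symm)
      exact ⟨X, fun _ => ⟨t, t', hX⟩⟩
    · exact ⟨∅, fun h => absurd h hx⟩
  choose F hF using hex
  have hmain := mul_numAffineHoles_add_card_le (k := 4) (m := 4) P E F
    (fun x hx => by
      obtain ⟨t, t', h⟩ := hF x hx
      exact h.isProjHole hP) ?_
  · omega
  intro x hx
  obtain ⟨t, t', hX⟩ := hF x hx
  refine (Finset.card_le_card_of_injOn Prod.fst (t := {x.1, x.2, t, t'}) ?_ ?_).trans
    Finset.card_le_four
  · intro y hy
    obtain ⟨hy, hyx⟩ := Finset.mem_filter.1 hy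
    obtain ⟨u, u', hY⟩ := hF y hy
    rw [hyx] at hY
    exact (hX.mem_iff _ hY.p_mem).1 ((hY.mem_iff _ hY.p_mem).2 (by simp))
  · rintro ⟨p, q⟩ hy ⟨p', q'⟩ hz (rfl : p = p')
    obtain ⟨hy, hyx⟩ := Finset.mem_filter.1 hy
    obtain ⟨hz, hzx⟩ := Finset.mem_filter.1 hz
    obtain ⟨u, u', hY⟩ := hF _ hy
    obtain ⟨v, v', hZ⟩ := hF _ hz
    rw [hyx] at hY
    rw [hzx] at hZ
    exact congrArg (Prod.mk p) (hY.eq_of_same_first hP hZ)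

theorem cast_offDiag_card (P : Finset Plane) :
    (P.offDiag.card : ℝ) = 2 * (P.card.choose 2 : ℝ) := by
  rw [Finset.offDiag_card, Nat.cast_sub (Nat.le_mul_self _), Nat.cast_choose_two]
  push_cast; ring

theorem mainTheorem7 (P : Finset Plane) (hP : InGeneralPosition (P : Set Plane)) :
    (P.card ≠ 2 →
      (numAffineHoles 3 (P : Set Plane) : ℝ) + (1 / 3 : ℝ) * (P.card.choose 2 : ℝ) ≤
        (numProjHoles 3 (toRP2 '' (P : Set Plane)) : ℝ)) ∧
    (P.card ≠ 0 →
      (numAffineHoles 4 (P : Set Plane) : ℝ) +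
          (1 / 2 : ℝ) * ((P.card.choose 2 : ℝ) - 3 * (P.card : ℝ) + 3) ≤
        (numProjHoles 4 (toRP2 '' (P : Set Plane)) : ℝ)) := by
  -- With no extra holes, the counting lemma reduces to the inclusion of affine holes among
  -- projective ones; this covers the cases of few points.
  have hle : ∀ k, numAffineHoles k (P : Set Plane) ≤
      numProjHoles k (toRP2 '' (P : Set Plane)) := fun k => by
    simpa using mul_numAffineHoles_add_card_le (k := k) (m := 1) P ∅ (fun _ => ∅) (by simp)
      (by simp)
  refine ⟨fun h2 => ?_, fun h0 => ?_⟩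
  · rcases lt_or_ge P.card 3 with h | h
    · rw [Nat.choose_eq_zero_of_lt (show P.card < 2 by omega)]
      simpa using hle 3
    · have := six_mul_numAffineHoles_three_le hP h
      have h' : (6 * numAffineHoles 3 (P : Set Plane) + P.offDiag.card : ℝ) ≤
        6 * numProjHoles 3 (toRP2 '' (P : Set Plane)) := by exact_mod_cast this
      rw [cast_offDiag_card] at h'
      linarith
  · rcases lt_or_ge P.card 2 with h | h
    · obtain h1 : P.card = 1 := by omega
      rw [h1]
      simpa using hle 4
    · have := four_mul_numAffineHoles_four_le hP
      have h' : (4 * numAffineHoles 4 (P : Set Plane) + P.offDiag.card : ℝ) ≤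
        4 * numProjHoles 4 (toRP2 '' (P : Set Plane)) + 2 * P.card := by exact_mod_cast this
      rw [cast_offDiag_card] at h'
      have h2 : (2 : ℝ) ≤ P.card := by exact_mod_cast h
      -- The loss n/2 from separated pairs is at most (3n - 3)/2 once n ≥ 2.
      linarith
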